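/- Let $P_n$ denote the Legendre polynomials normalized by $P_n(1)=1$, let $\varphi_n(x)=\sqrt{2n+1}\,P_n(2x-1)$, $n\ge 0$, be the orthonormal Legendre basis of the complex Hilbert space $L^2(0,1)$, and consider the frame $\Phi=\{\phi_0,\phi_1,\phi_2,\dots\}=\{\log x,\varphi_0,\varphi_1,\dots\}$. For $M,N\ge 1$ let $\mathcal{T}_N z=\sum_{n=0}^{N-1}z_n\phi_n$ for $z\in\mathbb{C}^N$, let $\mathcal{M}_M f=(\langle f,\varphi_m\rangle)_{m=0}^{M-1}\in\mathbb{C}^M$ be the data of $f\in L^2(0,1)$, and let $G_{M,N}=\mathcal{M}_M\mathcal{T}_N\in\mathbb{C}^{M\times N}$, with singular values $\sigma_n$ and left and right singular vectors $u_n$, $v_n$. For $\epsilon>0$ put $$\mathcal{L}^\epsilon_{M,N}y=\mathcal{T}_N\sum_{\sigma_n>\epsilon}\frac{\langle y,u_n\rangle}{\sigma_n}v_n,\qquad \mathcal{P}^\epsilon_{M,N}=\mathcal{L}^\epsilon_{M,N}\mathcal{M}_M,$$ $$\kappa^\epsilon_{M,N}=\max_{y\in\mathrm{Ran}(\mathcal{M}_M),\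 \|y\|=1}\|\mathcal{L}^\epsilon_{M,N}y\|,\qquad \lambda^\epsilon_{M,N}=\epsilon^{-1}\max_{z\in\mathbb{C}^N,\ \|z\|=1}\|\mathcal{T}_Nz-\mathcal{P}^\epsilon_{M,N}\mathcal{T}_Nz\|.$$ Let $A'$ be the largest constant with $A'\|f\|^2\le\liminf_{M\to\infty}\|\mathcal{M}_Mf\|^2$ for all $f\in L^2(0,1)$, and define the stable sampling rate $$\Theta^\epsilon(N,\theta)=\min\left\{M\in\mathbb{N}: M\ge N,\ \kappa^\epsilon_{M,N}\le\frac{\theta}{\sqrt{A'}},\ \lambda^\epsilon_{M,N}\le\frac{\theta}{\sqrt{A'}}\right\}.$$ Then for all $\epsilon>0$, all $\theta>1$ and all integers $N\ge1$ this minimum exists, and $$\Theta^\epsilon(N,\theta)\le\sqrt{\frac{\theta}{\theta-1}}\,N+1.$$ -/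

import Mathlib

open MeasureTheory Filter Set
open scoped InnerProductSpace ENNReal

noncomputable section

namespace FrameSampling

/-! ### Truncated singular value decomposition -/

section TruncatedSVD

variable {M N : ℕ} (G : EuclideanSpace ℂ (Fin N) →ₗ[ℂ] EuclideanSpace ℂ (Fin M))

/-- The right singular vectors `v_n`: an orthonormal eigenbasis of `G* G`, in the same order as
the singular values `G.singularValues n` (the square roots of the eigenvalues of `G* G`). -/
def rightSingularBasis : OrthonormalBasis (Fin N) ℂ (EuclideanSpace ℂ (Fin N)) :=
  G.isSymmetric_adjoint_comp_self.eigenvectorBasis finrank_euclideanSpace_fin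

/-- The left singular vector `u_n = G v_n / σ_n`. It is used only where `σ_n > 0`. -/
def leftSingularVector (n : Fin N) : EuclideanSpace ℂ (Fin M) :=
  ((G.singularValues n : ℂ)⁻¹) • G (rightSingularBasis G n)

/-- The vector `x = (G^ε)† y`, where `G^ε` keeps only the singular values larger than `ε`:
`x = ∑_{σ_n > ε} (⟨y, u_n⟩ / σ_n) v_n`. (The value does not depend on the choice of the singular
vectors. Mathlib's inner product is conjugate-linear in its first argument.) -/
def truncatedPinv (ε : ℝ) (y : EuclideanSpace ℂ (Fin M)) : EuclideanSpace ℂ (Fin N) :=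
  ∑ n ∈ Finset.univ.filter (fun n : Fin N => ε < G.singularValues n),
    (⟪leftSingularVector G n, y⟫_ℂ / (G.singularValues n : ℂ)) • rightSingularBasis G n

end TruncatedSVD

/-! ### Regularized frame approximation from indirect data

`Φ` is the system used for the approximation, truncated to its first `N` elements, and
`ℓ M m`, `m = 0, …, M - 1`, are the `M` functionals that supply the data. -/

section Approximation

variable {H : Type*} [NormedAddCommGroup H] [InnerProductSpace ℂ H]
  (Φ : ℕ → H) (ℓ : (M : ℕ) → Fin M → (H →ₗ[ℂ] ℂ))

/-- Truncated synthesis operator `T_N z = ∑_{n < N} z_n Φ_n`. -/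
def synthesis (N : ℕ) : EuclideanSpace ℂ (Fin N) →ₗ[ℂ] H where
  toFun z := ∑ n, z n • Φ n
  map_add' z w := by simp [add_smul, Finset.sum_add_distrib]
  map_smul' c z := by simp [mul_smul, Finset.smul_sum]

/-- The data map `f ↦ (ℓ_{m,M}(f))_{m < M}`. -/
def dataMap (M : ℕ) : H →ₗ[ℂ] EuclideanSpace ℂ (Fin M) where
  toFun f := WithLp.toLp 2 (fun m => ℓ M m f)
  map_add' f g := by ext m; simp
  map_smul' c f := by ext m; simp

/-- The operator of the matrix `G_{M,N} = (ℓ_{m,M}(Φ_n))_{m < M, n < N}`. -/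
def gram (M N : ℕ) : EuclideanSpace ℂ (Fin N) →ₗ[ℂ] EuclideanSpace ℂ (Fin M) :=
  dataMap ℓ M ∘ₗ synthesis Φ N

/-- The reconstruction map `L^ε_{M,N} y = T_N (G_{M,N}^ε)† y`. -/
def reconstruct (ε : ℝ) (M N : ℕ) (y : EuclideanSpace ℂ (Fin M)) : H :=
  synthesis Φ N (truncatedPinv (gram Φ ℓ M N) ε y)

/-- The truncated SVD approximation `P^ε_{M,N} f = L^ε_{M,N} (ℓ_{m,M}(f))_m`. -/
def approx (ε : ℝ) (M N : ℕ) (f : H) : H :=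
  reconstruct Φ ℓ ε M N (dataMap ℓ M f)

/-- `κ^ε_{M,N} = max { ‖L^ε_{M,N} y‖ : y in the range of the data map, ‖y‖ = 1 }`. -/
def kappa (ε : ℝ) (M N : ℕ) : ℝ :=
  sSup {r | ∃ y ∈ LinearMap.range (dataMap ℓ M), ‖y‖ = 1 ∧ r = ‖reconstruct Φ ℓ ε M N y‖}

/-- `λ^ε_{M,N} = ε⁻¹ max { ‖T_N z - P^ε_{M,N} T_N z‖ : ‖z‖ = 1 }`. -/
def lam (ε : ℝ) (M N : ℕ) : ℝ :=
  ε⁻¹ * sSup {r | ∃ z : EuclideanSpace ℂ (Fin N), ‖z‖ = 1 ∧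
    r = ‖synthesis Φ N z - approx Φ ℓ ε M N (synthesis Φ N z)‖}

/-- The optimal (largest) constant `A'` with
`A' ‖f‖² ≤ liminf_{M → ∞} ∑_{m < M} |ℓ_{m,M}(f)|²` for all `f`. -/
def lowerDataBound : ℝ :=
  sSup {a : ℝ | ∀ f : H, ((a * ‖f‖ ^ 2 : ℝ) : EReal) ≤
    liminf (fun M : ℕ => ((∑ m, ‖ℓ M m f‖ ^ 2 : ℝ) : EReal)) atTop}

/-- The numbers `M ≥ N` with `κ^ε_{M,N} ≤ θ / √A'` and `λ^ε_{M,N} ≤ θ / √A'`. -/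
def stableSampleSizes (ε : ℝ) (N : ℕ) (θ : ℝ) : Set ℕ :=
  {M | N ≤ M ∧ kappa Φ ℓ ε M N ≤ θ / √(lowerDataBound ℓ) ∧
    lam Φ ℓ ε M N ≤ θ / √(lowerDataBound ℓ)}

/-- The stable sampling rate `Θ^ε(N, θ)`, the least element of `stableSampleSizes`
(with junk value `0` if there is none). -/
def stableSamplingRate (ε : ℝ) (N : ℕ) (θ : ℝ) : ℕ :=
  sInf (stableSampleSizes Φ ℓ ε N θ)

end Approximation

/-! ### Legendre polynomials and the logarithm on `(0,1)` -/

/-- Lebesgue measure on `(0,1)`. -/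
abbrev unitMeasure : Measure ℝ := volume.restrict (Ioo 0 1)

/-- The complex Hilbert space `L²(0,1)`. -/
abbrev L2unit : Type := Lp ℂ 2 unitMeasure

/-- `φ_n(x) = √(2n+1) P_n(2x-1)`, with `P_n` the Legendre polynomial normalized by `P_n(1) = 1`.
Mathlib's `shiftedLegendre n` is `P_n(1-2x) = (-1)^n P_n(2x-1)`. -/
def legendreFun (n : ℕ) (x : ℝ) : ℝ :=
  √(2 * n + 1) * ((-1) ^ n * Polynomial.aeval x (Polynomial.shiftedLegendre n))

theorem memLp_legendreFun (n : ℕ) :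
    MemLp (fun x => (legendreFun n x : ℂ)) 2 unitMeasure := by
  have hc : Continuous (fun x => (legendreFun n x : ℂ)) := by
    unfold legendreFun
    fun_prop
  obtain ⟨C, hC⟩ := (isCompact_Icc (a := (0 : ℝ)) (b := 1)).exists_bound_of_continuousOn
    hc.continuousOn
  refine MemLp.of_bound hc.aestronglyMeasurable C ?_
  filter_upwards [ae_restrict_mem measurableSet_Ioo] with x hx
  exact hC x (Ioo_subset_Icc_self hx)

theorem memLp_log : MemLp (fun x => (Real.log x : ℂ)) 2 unitMeasure := by
  have hm : AEStronglyMeasurable (fun x => (Real.log x : ℂ)) unitMeasure :=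
    (Complex.measurable_ofReal.comp Real.measurable_log).aestronglyMeasurable
  rw [memLp_two_iff_integrable_sq_norm hm]
  have hi : IntegrableOn (fun x : ℝ => 16 * x ^ (-(1 / 2) : ℝ)) (Ioo 0 1) := by
    refine Integrable.const_mul ?_ _
    exact (intervalIntegral.integrableOn_Ioo_rpow_iff one_pos).2 (by norm_num)
  refine Integrable.mono' hi (hm.norm.pow 2) ?_
  filter_upwards [ae_restrict_mem measurableSet_Ioo] with x hx
  have h0 : (0 : ℝ) < x := hx.1
  have h := Real.abs_log_mul_self_rpow_lt x (1 / 4) h0 hx.2.le (by norm_num)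
  have hp : 0 < x ^ (1 / 4 : ℝ) := Real.rpow_pos_of_pos h0 _
  rw [abs_mul, abs_of_pos hp] at h
  have hs : (|Real.log x| * x ^ (1 / 4 : ℝ)) ^ 2 ≤ 16 := by
    have h' : |Real.log x| * x ^ (1 / 4 : ℝ) ≤ 4 := by linarith
    have := pow_le_pow_left₀ (by positivity) h' 2
    linarith
  have he : (x ^ (1 / 4 : ℝ)) ^ 2 = x ^ (1 / 2 : ℝ) := by
    rw [← Real.rpow_natCast, ← Real.rpow_mul h0.le]; norm_num
  rw [mul_pow, he] at hs
  rw [Real.norm_of_nonneg (by positivity), Complex.norm_real, Real.norm_eq_abs,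
    Real.rpow_neg h0.le, ← div_eq_mul_inv, le_div_iff₀ (Real.rpow_pos_of_pos h0 _)]
  exact hs

/-- The Legendre basis of `L²(0,1)`. -/
def legendre (n : ℕ) : L2unit := (memLp_legendreFun n).toLp _

/-- The function `log x` as an element of `L²(0,1)`. -/
def logElem : L2unit := memLp_log.toLp _

/-- The Legendre basis augmented by the logarithm: `log, φ_0, φ_1, φ_2, …`. -/
def legendreLog : ℕ → L2unit
  | 0 => logElem
  | n + 1 => legendre n

/-- The data: the first `M` Legendre coefficients `⟨f, φ_m⟩`, `m = 0, …, M - 1`. -/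
def legendreData (M : ℕ) (m : Fin M) : L2unit →ₗ[ℂ] ℂ := (innerSL ℂ (legendre m)).toLinearMap

end FrameSampling

end

/-! Write `T` for the synthesis operator and `G` for the Gram matrix. The squared Legendre
coefficients of the logarithm are `1/n² - 1/(n+1)²` for `n ≥ 1`, so they telescope. In `f = T z`
only the logarithm reaches coefficients of index at least `N - 1`; hence Parseval gives `‖f‖² = ‖G
z‖² + |z₀|²/M²` for every `M ≥ N` (`norm_sq_synthesis_legendreLog`). The case `M = N` shows `|z₀|² ≤
N² ‖f‖²`, so `‖G z‖² ≥ (1 - N²/M²) ‖f‖² ≥ ‖f‖²/θ` once `M² ≥ θ N²/(θ - 1)`.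

Any bound `‖T z‖ ≤ K ‖G z‖` passes to both stability constants, whatever `ε` is (`kappa_le`,
`lam_le`): the truncated pseudoinverse composed with `G` is an orthogonal projection, and the
discarded singular values are at most `ε`. Since `A' = 1`, `K = θ` suffices. -/

namespace FrameSampling

/-! ### Shifted Legendre polynomials: orthogonality and logarithmic moments -/

open Polynomial in
/-- The shifted Legendre polynomial `P_n(1 - 2x)` with real coefficients. -/
noncomputable def realLegendre (n : ℕ) : ℝ[X] := (shiftedLegendre n).map (Int.castRingHom ℝ)

section RealPolynomials

open Polynomial

theorem eval_realLegendre (n : ℕ) (x : ℝ) :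
    (realLegendre n).eval x = aeval x (shiftedLegendre n) := by
  simp [realLegendre, aeval_def, eval_map]

theorem coeff_realLegendre (n k : ℕ) :
    (realLegendre n).coeff k = (-1) ^ k * n.choose k * (n + k).choose n := by
  simp [realLegendre, coeff_shiftedLegendre]

theorem eval_zero_realLegendre (n : ℕ) : (realLegendre n).eval 0 = 1 := by
  rw [← coeff_zero_eq_eval_zero, coeff_realLegendre]; simp

theorem eval_one_realLegendre (n : ℕ) : (realLegendre n).eval 1 = (-1) ^ n := by
  have h := eval_zero_realLegendre n
  rw [eval_realLegendre] at h
  rw [eval_realLegendre, shiftedLegendre_eval_symm, sub_self, h, mul_one]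

theorem degree_realLegendre (n : ℕ) : (realLegendre n).degree = n := by
  rw [realLegendre, degree_map_eq_of_injective (RingHom.injective_int _), degree_shiftedLegendre]

theorem coeff_self_realLegendre_ne_zero (n : ℕ) : (realLegendre n).coeff n ≠ 0 :=
  coeff_ne_zero_of_eq_degree (degree_realLegendre n)

/-- The Legendre differential equation, read off coefficientwise. -/
theorem coeff_succ_realLegendre (n k : ℕ) :
    ((k : ℝ) + 1) ^ 2 * (realLegendre n).coeff (k + 1) =
      (k * (k + 1) - n * (n + 1)) * (realLegendre n).coeff k := by
  have h1 : ((n.choose (k + 1) : ℕ) : ℝ) * (k + 1) = n.choose k * (n - k) := by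
    rcases le_or_gt k n with h | h
    · have := congrArg (Nat.cast (R := ℝ)) (Nat.choose_succ_right_eq n k)
      push_cast [Nat.cast_sub h] at this
      exact this
    · simp [Nat.choose_eq_zero_of_lt h, Nat.choose_eq_zero_of_lt (Nat.lt_succ_of_lt h)]
  have h2 : (((n + (k + 1)).choose n : ℕ) : ℝ) * (k + 1) = (n + k).choose n * (n + k + 1) := by
    have := congrArg (Nat.cast (R := ℝ)) (Nat.choose_mul_succ_eq (n + k) n)
    rw [show n + k + 1 - n = k + 1 by omega] at this
    push_cast at this
    rw [← add_assoc]
    exact this.symm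
  rw [coeff_realLegendre, coeff_realLegendre, pow_succ (-1 : ℝ) k]
  linear_combination (-1 : ℝ) ^ k * (-(((n + (k + 1)).choose n : ℕ) : ℝ) * (k + 1) * h1
    - (n.choose k : ℝ) * (n - k) * h2)

/-- The Legendre differential equation. -/
theorem derivative_mul_derivative_realLegendre (n : ℕ) :
    derivative ((X * (1 - X)) * derivative (realLegendre n)) =
      C (-((n : ℝ) * (n + 1))) * realLegendre n := by
  ext k
  have h := coeff_succ_realLegendre n k
  have e : (X * (1 - X)) * derivative (realLegendre n) =
      X * derivative (realLegendre n) - X * (X * derivative (realLegendre n)) := by ring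
  rw [e, coeff_derivative, coeff_sub, coeff_X_mul, coeff_X_mul, coeff_derivative, coeff_C_mul]
  cases k with
  | zero => simp at h ⊢; linarith
  | succ k =>
    rw [coeff_X_mul, coeff_derivative]
    push_cast at h ⊢
    linarith

/-- Exact degrees allow the leading term to be subtracted repeatedly. Serves both orthogonality to
lower degrees and density. -/
theorem mem_of_realLegendre_mem (S : Submodule ℝ ℝ[X]) (n : ℕ)
    (h : ∀ k < n, realLegendre k ∈ S) (p : ℝ[X]) (hp : p.degree < n) : p ∈ S := by
  induction n generalizing p with
  | zero =>
    have : p = 0 := by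
      rw [← degree_eq_bot]
      exact Nat.WithBot.lt_zero_iff.mp hp
    simp [this]
  | succ n ih =>
    set c := p.coeff n / (realLegendre n).coeff n with hc
    have hq : p - c • realLegendre n ∈ S := by
      refine ih (fun k hk => h k (by omega)) _ ?_
      rw [degree_lt_iff_coeff_zero]
      intro m hm
      rcases hm.eq_or_lt with rfl | hm
      · simp [hc, coeff_self_realLegendre_ne_zero]
      · have h1 : p.coeff m = 0 := coeff_eq_zero_of_degree_lt (hp.trans_le (by exact_mod_cast hm))
        have h2 : (realLegendre n).coeff m = 0 :=
          coeff_eq_zero_of_degree_lt (by rw [degree_realLegendre]; exact_mod_cast hm)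
        simp [h1, h2]
    have := S.add_mem hq (S.smul_mem c (h n (by omega)))
    simpa using this

theorem integral_eval_derivative (p : ℝ[X]) :
    ∫ x in (0 : ℝ)..1, (derivative p).eval x = p.eval 1 - p.eval 0 :=
  intervalIntegral.integral_eq_sub_of_hasDerivAt (fun x _ => p.hasDerivAt x)
    ((derivative p).continuous.intervalIntegrable _ _)

/-- Integration over `[0, 1]` as a linear functional on polynomials. -/
noncomputable def polyIntegral : ℝ[X] →ₗ[ℝ] ℝ where
  toFun p := ∫ x in (0 : ℝ)..1, p.eval x
  map_add' p q := by
    simp only [eval_add]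
    exact intervalIntegral.integral_add (p.continuous.intervalIntegrable _ _)
      (q.continuous.intervalIntegrable _ _)
  map_smul' c p := by simp [eval_smul]

theorem polyIntegral_derivative (p : ℝ[X]) :
    polyIntegral (derivative p) = p.eval 1 - p.eval 0 := integral_eval_derivative p

theorem polyIntegral_C_mul (c : ℝ) (p : ℝ[X]) :
    polyIntegral (C c * p) = c * polyIntegral p := by
  rw [← smul_eq_C_mul, map_smul, smul_eq_mul]

/-- Sturm–Liouville argument: the weight `X(1 - X)` kills the boundary terms, and the eigenvalues
`n(n+1)` are distinct. -/
theorem polyIntegral_realLegendre_mul_of_ne {m n : ℕ} (hmn : m ≠ n) :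
    polyIntegral (realLegendre m * realLegendre n) = 0 := by
  have hm := derivative_mul_derivative_realLegendre m
  have hn := derivative_mul_derivative_realLegendre n
  set p := realLegendre m
  set q := realLegendre n
  have h := polyIntegral_derivative
    ((X * (1 - X) * derivative p) * q - p * (X * (1 - X) * derivative q))
  have e : derivative ((X * (1 - X) * derivative p) * q - p * (X * (1 - X) * derivative q)) =
      C (-((m : ℝ) * (m + 1)) + n * (n + 1)) * (p * q) := by
    rw [derivative_sub, derivative_mul (f := X * (1 - X) * derivative p), derivative_mul (f := p),
      hm, hn, C_add, C_neg (a := (n : ℝ) * (n + 1))]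
    ring
  rw [e, polyIntegral_C_mul] at h
  simp only [eval_sub, eval_mul, eval_X, eval_one, sub_self, mul_zero, zero_mul] at h
  rcases mul_eq_zero.mp h with h | h
  · exfalso
    have h' : ((n : ℝ) - m) * (n + m + 1) = 0 := by linarith
    rcases mul_eq_zero.mp h' with h' | h'
    · exact hmn (by exact_mod_cast (sub_eq_zero.mp h').symm)
    · exact absurd h' (by positivity)
  · exact h

theorem polyIntegral_mul_realLegendre_of_degree_lt {n : ℕ} {p : ℝ[X]} (hp : p.degree < n) :
    polyIntegral (p * realLegendre n) = 0 :=
  mem_of_realLegendre_mem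
    (LinearMap.ker (polyIntegral ∘ₗ LinearMap.mulRight ℝ (realLegendre n))) n
    (fun k hk => by
      simpa using polyIntegral_realLegendre_mul_of_ne hk.ne) p hp

/-- Integrate `(X p²)' = (2n+1) p² + 2 (X p' - n p) p`; the leading term of `X p' - n p` cancels, so
its product with `p` integrates to zero. -/
theorem polyIntegral_realLegendre_mul_self (n : ℕ) :
    (2 * (n : ℝ) + 1) * polyIntegral (realLegendre n * realLegendre n) = 1 := by
  set p := realLegendre n with hpdef
  have h := polyIntegral_derivative (X * (p * p))
  have hr : (X * derivative p - C (n : ℝ) * p).degree < (n : WithBot ℕ) := by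
    rw [degree_lt_iff_coeff_zero]
    intro m hm
    rcases hm.eq_or_lt with rfl | hm
    · cases n with
      | zero => simp
      | succ n => rw [coeff_sub, coeff_X_mul, coeff_derivative, coeff_C_mul]; push_cast; ring
    · have h1 : p.coeff m = 0 :=
        coeff_eq_zero_of_degree_lt (by rw [degree_realLegendre]; exact_mod_cast hm)
      obtain ⟨k, rfl⟩ : ∃ k, m = k + 1 := ⟨m - 1, by omega⟩
      rw [coeff_sub, coeff_X_mul, coeff_derivative, coeff_C_mul, h1]; ring
  have h0 := polyIntegral_mul_realLegendre_of_degree_lt hr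
  rw [← hpdef] at h0
  have e : derivative (X * (p * p)) =
      C (2 * (n : ℝ) + 1) * (p * p) + C 2 * ((X * derivative p - C (n : ℝ) * p) * p) := by
    rw [derivative_mul, derivative_mul, derivative_X, C_add, C_mul, C_1]
    have : (C 2 : ℝ[X]) = 2 := rfl
    rw [this]
    ring
  rw [e, map_add, polyIntegral_C_mul, polyIntegral_C_mul, h0] at h
  simp only [eval_mul, eval_X, hpdef, eval_one_realLegendre, zero_mul, one_mul, sub_zero,
    ← mul_pow] at h
  simpa using h

/-- Integrating the derivative of `x(1 - x) p' log x` gives `-n(n+1) ∫ p log + ∫ (1 - x) p' = 0`,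
and the last integral is `-p(0) + ∫ p = -1`. -/
theorem integral_log_mul_realLegendre {n : ℕ} (hn : 1 ≤ n) :
    ∫ x in (0 : ℝ)..1, Real.log x * (realLegendre n).eval x = -1 / (n * (n + 1)) := by
  have hode := derivative_mul_derivative_realLegendre n
  have hint0 := polyIntegral_mul_realLegendre_of_degree_lt (n := n) (p := 1)
    (by rw [degree_one]; exact_mod_cast hn)
  set p := realLegendre n with hp
  have hI : ∀ q : ℝ[X], IntervalIntegrable (fun x => Real.log x * q.eval x) volume 0 1 :=
    fun q => intervalIntegral.intervalIntegrable_log'.mul_continuousOn q.continuous.continuousOn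
  have hJ : IntervalIntegrable (fun x => ((1 - X) * derivative p).eval x) volume 0 1 :=
    (Polynomial.continuous _).intervalIntegrable _ _
  have hF : ∫ x in (0 : ℝ)..1, (Real.log x * (C (-((n : ℝ) * (n + 1))) * p).eval x +
      ((1 - X) * derivative p).eval x) = 0 := by
    -- Grouping `x` with `log x` makes the primitive continuous at `0`.
    have := intervalIntegral.integral_eq_sub_of_hasDerivAt_of_le (a := 0) (b := 1)
      (f := fun x => (x * Real.log x) * ((1 - X) * derivative p).eval x)
      (f' := fun x => Real.log x * (C (-((n : ℝ) * (n + 1))) * p).eval x +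
        ((1 - X) * derivative p).eval x) zero_le_one
      (Real.continuous_mul_log.mul (Polynomial.continuous _)).continuousOn
      (fun x hx => ?_)
      (IntervalIntegrable.add (g := fun x => ((1 - X) * derivative p).eval x) (hI _) hJ)
    · rw [this]; simp
    · have hx0 : x ≠ 0 := hx.1.ne'
      have h1 := (Real.hasDerivAt_log hx0).mul
        (((X * (1 - X)) * derivative p).hasDerivAt x)
      rw [hode] at h1
      refine (h1.congr_of_eventuallyEq (Eventually.of_forall fun y => ?_)).congr_deriv ?_
      · simp only [eval_mul, eval_X, Pi.mul_apply]; ring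
      · simp only [eval_mul, eval_X]; field_simp; ring
  have hG : ∫ x in (0 : ℝ)..1, ((1 - X) * derivative p).eval x = -1 := by
    have h1 := polyIntegral_derivative ((1 - X) * p)
    have e : derivative ((1 - X) * p) = (1 - X) * derivative p - 1 * p := by
      rw [derivative_mul, derivative_sub, derivative_one, derivative_X]; ring
    rw [e, map_sub, hint0] at h1
    simp [hp, eval_zero_realLegendre] at h1
    simpa [polyIntegral] using h1
  rw [intervalIntegral.integral_add (hI _) hJ, hG] at hF
  simp only [eval_mul, eval_C, mul_left_comm (Real.log _),
    intervalIntegral.integral_const_mul] at hF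
  have : (0 : ℝ) < n := by exact_mod_cast hn
  field_simp
  linarith

end RealPolynomials

end FrameSampling

/-! ### Legendre basis of `L²(0,1)`, Parseval, and `A' = 1` -/

namespace FrameSampling

theorem inner_toLp_ofReal {f g : ℝ → ℝ} (hf : MemLp (fun x => (f x : ℂ)) 2 unitMeasure)
    (hg : MemLp (fun x => (g x : ℂ)) 2 unitMeasure) :
    ⟪hf.toLp _, hg.toLp _⟫_ℂ = ((∫ x in (0 : ℝ)..1, g x * f x : ℝ) : ℂ) := by
  rw [L2.inner_def, intervalIntegral.integral_of_le zero_le_one, integral_Ioc_eq_integral_Ioo,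
    ← integral_complex_ofReal]
  refine integral_congr_ae ?_
  filter_upwards [hf.coeFn_toLp, hg.coeFn_toLp] with x h1 h2
  rw [h1, h2]
  simp

section PolynomialElements

open Polynomial

theorem memLp_eval (p : ℝ[X]) : MemLp (fun x => ((p.eval x : ℝ) : ℂ)) 2 unitMeasure := by
  have hc : Continuous (fun x => ((p.eval x : ℝ) : ℂ)) := by fun_prop
  obtain ⟨C, hC⟩ := (isCompact_Icc (a := (0 : ℝ)) (b := 1)).exists_bound_of_continuousOn
    hc.continuousOn
  refine MemLp.of_bound hc.aestronglyMeasurable C ?_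
  filter_upwards [ae_restrict_mem measurableSet_Ioo] with x hx
  exact hC x (Ioo_subset_Icc_self hx)

/-- A real polynomial as an element of `L²(0,1)`. -/
noncomputable def polyElem : ℝ[X] →ₗ[ℝ] L2unit where
  toFun p := (memLp_eval p).toLp _
  map_add' p q := by
    rw [← MemLp.toLp_add]
    congr 1
    ext x
    simp
  map_smul' c p := by
    rw [RingHom.id_apply, ← MemLp.toLp_const_smul]
    congr 1
    ext x
    simp

theorem inner_polyElem (p q : ℝ[X]) :
    ⟪polyElem p, polyElem q⟫_ℂ = (polyIntegral (q * p) : ℂ) := by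
  refine (inner_toLp_ofReal (memLp_eval p) (memLp_eval q)).trans ?_
  simp [polyIntegral]

theorem inner_polyElem_logElem (p : ℝ[X]) :
    ⟪polyElem p, logElem⟫_ℂ = ((∫ x in (0 : ℝ)..1, Real.log x * p.eval x : ℝ) : ℂ) :=
  inner_toLp_ofReal (memLp_eval p) memLp_log

theorem legendre_eq_smul_polyElem (n : ℕ) :
    legendre n = ((√(2 * n + 1) * (-1) ^ n : ℝ) : ℂ) • polyElem (realLegendre n) := by
  change _ = _ • (memLp_eval _).toLp _
  rw [← MemLp.toLp_const_smul, legendre]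
  congr 1
  ext x
  simp [legendreFun, eval_realLegendre, mul_assoc]

theorem sqrt_mul_neg_one_pow_sq (n : ℕ) :
    (√(2 * (n : ℝ) + 1) * (-1) ^ n) * (√(2 * n + 1) * (-1) ^ n) = 2 * n + 1 := by
  have h : √(2 * (n : ℝ) + 1) * √(2 * n + 1) = 2 * n + 1 := Real.mul_self_sqrt (by positivity)
  have h' : (-1 : ℝ) ^ n * (-1) ^ n = 1 := by rw [← mul_pow]; simp
  linear_combination (-1 : ℝ) ^ n * (-1) ^ n * h + (2 * (n : ℝ) + 1) * h'

theorem orthonormal_legendre : Orthonormal ℂ legendre := by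
  rw [orthonormal_iff_ite]
  intro m n
  rw [legendre_eq_smul_polyElem, legendre_eq_smul_polyElem, inner_smul_left, inner_smul_right,
    inner_polyElem, Complex.conj_ofReal, ← Complex.ofReal_mul, ← Complex.ofReal_mul]
  split_ifs with h
  · subst h
    rw [← mul_assoc, sqrt_mul_neg_one_pow_sq, polyIntegral_realLegendre_mul_self,
      Complex.ofReal_one]
  · rw [polyIntegral_realLegendre_mul_of_ne (Ne.symm h)]
    simp

/-- The value `(2n+1)/(n²(n+1)²)` in telescoping form, which makes the tail sums exact. -/
theorem norm_sq_inner_legendre_logElem {n : ℕ} (hn : 1 ≤ n) :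
    ‖⟪legendre n, logElem⟫_ℂ‖ ^ 2 = 1 / (n : ℝ) ^ 2 - 1 / ((n + 1 : ℕ) : ℝ) ^ 2 := by
  rw [legendre_eq_smul_polyElem, inner_smul_left, inner_polyElem_logElem,
    integral_log_mul_realLegendre hn, Complex.conj_ofReal, ← Complex.ofReal_mul,
    Complex.norm_real, Real.norm_eq_abs, sq_abs, mul_pow, sq (_ * _), sqrt_mul_neg_one_pow_sq]
  have : (0 : ℝ) < n := by exact_mod_cast hn
  push_cast
  field_simp
  ring

theorem polyElem_mem_span (p : ℝ[X]) : polyElem p ∈ Submodule.span ℂ (range legendre) := by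
  refine mem_of_realLegendre_mem
    (((Submodule.span ℂ (range legendre)).restrictScalars ℝ).comap polyElem) (p.natDegree + 1)
    (fun k _ => ?_) p ?_
  · change polyElem (realLegendre k) ∈ Submodule.span ℂ (range legendre)
    have hc : ((√(2 * k + 1) * (-1) ^ k : ℝ) : ℂ) ≠ 0 := by
      have := sqrt_mul_neg_one_pow_sq k
      intro h
      rw [Complex.ofReal_eq_zero] at h
      rw [h] at this
      have : (0 : ℝ) < 2 * k + 1 := by positivity
      linarith
    have h := Submodule.subset_span (R := ℂ) (mem_range_self (f := legendre) k)
    rw [SetLike.mem_coe, legendre_eq_smul_polyElem] at h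
    exact (Submodule.smul_mem_iff _ hc).mp h
  · exact degree_le_natDegree.trans_lt (by exact_mod_cast Nat.lt_succ_self _)

/-- Weierstrass approximation of the real and imaginary parts; uniform bounds control the `L²` norm
on a space of mass one. -/
theorem mem_closure_span_legendre (f : BoundedContinuousFunction ℝ ℂ) :
    BoundedContinuousFunction.toLp 2 unitMeasure ℂ f ∈
      closure (Submodule.span ℂ (range legendre) : Set L2unit) := by
  rw [Metric.mem_closure_iff]
  intro ε hε
  obtain ⟨p, hp⟩ := exists_polynomial_near_of_continuousOn 0 1 (fun x => (f x).re)
    (by fun_prop) (ε / 4) (by positivity)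
  obtain ⟨q, hq⟩ := exists_polynomial_near_of_continuousOn 0 1 (fun x => (f x).im)
    (by fun_prop) (ε / 4) (by positivity)
  refine ⟨polyElem p + Complex.I • polyElem q,
    add_mem (polyElem_mem_span p) (Submodule.smul_mem _ _ (polyElem_mem_span q)), ?_⟩
  rw [dist_eq_norm]
  have hb : ‖BoundedContinuousFunction.toLp 2 unitMeasure ℂ f -
      (polyElem p + Complex.I • polyElem q)‖ ≤
      (unitMeasure.real univ) ^ (2 : ℝ≥0∞).toReal⁻¹ * (ε / 2) := by
    have hε2 : 0 ≤ ε / 2 := by positivity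
    refine Lp.norm_le_of_ae_bound hε2 ?_
    filter_upwards [ae_restrict_mem measurableSet_Ioo,
      BoundedContinuousFunction.coeFn_toLp (p := 2) unitMeasure ℂ f,
      (memLp_eval p).coeFn_toLp, (memLp_eval q).coeFn_toLp,
      Lp.coeFn_sub (BoundedContinuousFunction.toLp 2 unitMeasure ℂ f)
        (polyElem p + Complex.I • polyElem q),
      Lp.coeFn_add (polyElem p) (Complex.I • polyElem q),
      Lp.coeFn_smul Complex.I (polyElem q)] with x hx h1 h2 h3 h4 h5 h6
    have h2' : polyElem p x = ((p.eval x : ℝ) : ℂ) := h2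
    have h3' : polyElem q x = ((q.eval x : ℝ) : ℂ) := h3
    rw [h4, Pi.sub_apply, h5, Pi.add_apply, h6, Pi.smul_apply, h1, h2', h3']
    refine (Complex.norm_le_abs_re_add_abs_im _).trans ?_
    have e1 := hp x (Ioo_subset_Icc_self hx)
    have e2 := hq x (Ioo_subset_Icc_self hx)
    rw [abs_sub_comm] at e1 e2
    simp
    linarith
  refine hb.trans_lt ?_
  have : unitMeasure.real univ = 1 := by simp [Measure.real]
  rw [this, Real.one_rpow]
  linarith

theorem dense_span_legendre : ⊤ ≤ (Submodule.span ℂ (range legendre)).topologicalClosure := by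
  intro f _
  have hd := BoundedContinuousFunction.toLp_denseRange (p := 2) ℂ unitMeasure ℂ
    ENNReal.ofNat_ne_top
  have hsub := closure_mono (range_subset_iff.mpr mem_closure_span_legendre)
  rw [closure_closure] at hsub
  exact hsub (hd f)

end PolynomialElements

theorem hasSum_norm_sq_inner_legendre (f : L2unit) :
    HasSum (fun n => ‖⟪legendre n, f⟫_ℂ‖ ^ 2) (‖f‖ ^ 2) := by
  have h := (HilbertBasis.mk orthonormal_legendre dense_span_legendre).hasSum_inner_mul_inner f f
  rw [HilbertBasis.coe_mk, inner_self_eq_norm_sq_to_K] at h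
  have h' := Complex.hasSum_re h
  convert h' using 1
  · ext n
    rw [← inner_conj_symm f, mul_comm, Complex.mul_conj, Complex.normSq_eq_norm_sq]
    exact (Complex.ofReal_re _).symm
  · norm_cast

theorem tendsto_sum_norm_sq_legendreData (f : L2unit) :
    Tendsto (fun M : ℕ => ∑ m, ‖legendreData M m f‖ ^ 2) atTop (nhds (‖f‖ ^ 2)) := by
  refine (hasSum_norm_sq_inner_legendre f).tendsto_sum_nat.congr fun M => ?_
  exact (Fin.sum_univ_eq_sum_range (fun n => ‖⟪legendre n, f⟫_ℂ‖ ^ 2) M).symm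

theorem lowerDataBound_legendreData : lowerDataBound legendreData = 1 := by
  have hl : ∀ f : L2unit,
      liminf (fun M : ℕ => ((∑ m, ‖legendreData M m f‖ ^ 2 : ℝ) : EReal)) atTop =
        ((‖f‖ ^ 2 : ℝ) : EReal) := fun f =>
    ((continuous_coe_real_ereal.tendsto _).comp (tendsto_sum_norm_sq_legendreData f)).liminf_eq
  have hs : {a : ℝ | ∀ f : L2unit, ((a * ‖f‖ ^ 2 : ℝ) : EReal) ≤
      liminf (fun M : ℕ => ((∑ m, ‖legendreData M m f‖ ^ 2 : ℝ) : EReal)) atTop} = Iic 1 := by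
    ext a
    simp only [hl, EReal.coe_le_coe_iff, mem_ofPred_eq, mem_Iic]
    refine ⟨fun h => ?_, fun h f => ?_⟩
    · simpa [orthonormal_legendre.1 0] using h (legendre 0)
    · nlinarith [sq_nonneg ‖f‖]
  rw [lowerDataBound, hs, csSup_Iic]

end FrameSampling

/-! ### Estimates for the truncated pseudoinverse -/

namespace FrameSampling

section TruncatedSVD

variable {M N : ℕ} (G : EuclideanSpace ℂ (Fin N) →ₗ[ℂ] EuclideanSpace ℂ (Fin M))

theorem inner_map_rightSingularBasis (n : Fin N) (x : EuclideanSpace ℂ (Fin N)) :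
    ⟪G (rightSingularBasis G n), G x⟫_ℂ =
      (G.singularValues n : ℂ) ^ 2 * ⟪rightSingularBasis G n, x⟫_ℂ := by
  have h := G.isSymmetric_adjoint_comp_self.apply_eigenvectorBasis finrank_euclideanSpace_fin n
  rw [← LinearMap.adjoint_inner_left, ← LinearMap.comp_apply, rightSingularBasis, h,
    inner_smul_left, ← G.sq_singularValues_fin finrank_euclideanSpace_fin]
  simp

theorem norm_sq_map_eq_sum (x : EuclideanSpace ℂ (Fin N)) :
    ‖G x‖ ^ 2 = ∑ n : Fin N, G.singularValues n ^ 2 * ‖⟪rightSingularBasis G n, x⟫_ℂ‖ ^ 2 := by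
  have h : ⟪G x, G x⟫_ℂ = ((∑ n : Fin N, G.singularValues n ^ 2 *
      ‖⟪rightSingularBasis G n, x⟫_ℂ‖ ^ 2 : ℝ) : ℂ) := by
    conv_lhs =>
      enter [2]
      rw [← (rightSingularBasis G).sum_repr' x, map_sum]
    rw [sum_inner]
    push_cast
    refine Finset.sum_congr rfl fun n _ => ?_
    rw [map_smul, inner_smul_left, inner_map_rightSingularBasis, ← Complex.conj_mul']
    ring
  rw [inner_self_eq_norm_sq_to_K] at h
  exact Complex.ofReal_injective (by rw [← h]; norm_cast)

theorem inner_rightSingularBasis_truncatedPinv (ε : ℝ) (y : EuclideanSpace ℂ (Fin M))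
    (n : Fin N) :
    ⟪rightSingularBasis G n, truncatedPinv G ε y⟫_ℂ =
      if ε < G.singularValues n then ⟪leftSingularVector G n, y⟫_ℂ / (G.singularValues n : ℂ)
      else 0 := by
  rw [truncatedPinv, inner_sum]
  simp [inner_smul_right, orthonormal_iff_ite.mp (rightSingularBasis G).orthonormal,
    Finset.sum_ite_eq]

theorem inner_rightSingularBasis_truncatedPinv_of_lt {ε : ℝ} (hε : 0 < ε)
    (y : EuclideanSpace ℂ (Fin M)) {n : Fin N} (hn : ε < G.singularValues n) :
    (G.singularValues n : ℂ) ^ 2 * ⟪rightSingularBasis G n, truncatedPinv G ε y⟫_ℂ =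
      ⟪G (rightSingularBasis G n), y⟫_ℂ := by
  have h0 : (G.singularValues n : ℂ) ≠ 0 := by exact_mod_cast (hε.trans hn).ne'
  rw [inner_rightSingularBasis_truncatedPinv, if_pos hn, leftSingularVector, inner_smul_left]
  simp only [map_inv₀, Complex.conj_ofReal]
  field_simp

/-- `G z` is the orthogonal projection of `y` onto the span of the retained left singular vectors.
-/
theorem norm_map_truncatedPinv_le {ε : ℝ} (hε : 0 < ε) (y : EuclideanSpace ℂ (Fin M)) :
    ‖G (truncatedPinv G ε y)‖ ≤ ‖y‖ := by
  set z := truncatedPinv G ε y with hz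
  have h : ⟪G z, G z⟫_ℂ = ⟪G z, y⟫_ℂ := by
    have e : G z = ∑ n : Fin N, ⟪rightSingularBasis G n, z⟫_ℂ • G (rightSingularBasis G n) := by
      conv_lhs => rw [← (rightSingularBasis G).sum_repr' z, map_sum]
      simp
    conv_lhs => rw [e, sum_inner]
    conv_rhs => rw [e, sum_inner]
    rw [← e]
    refine Finset.sum_congr rfl fun n _ => ?_
    rw [inner_smul_left, inner_smul_left]
    by_cases hn : ε < G.singularValues n
    · rw [inner_map_rightSingularBasis, hz,
        inner_rightSingularBasis_truncatedPinv_of_lt G hε y hn]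
    · rw [hz, inner_rightSingularBasis_truncatedPinv, if_neg hn]
      simp
  have h1 : ‖G z‖ * ‖G z‖ ≤ ‖G z‖ * ‖y‖ := by
    rw [← inner_self_eq_norm_mul_norm (𝕜 := ℂ), h]
    exact re_inner_le_norm _ _
  rcases (norm_nonneg (G z)).eq_or_lt with h0 | h0
  · rw [← h0]; exact norm_nonneg y
  · exact le_of_mul_le_mul_left h1 h0

/-- Retained components cancel; each remaining one is scaled by some `σ_n ≤ ε`. -/
theorem norm_map_sub_truncatedPinv_le {ε : ℝ} (hε : 0 < ε) (z : EuclideanSpace ℂ (Fin N)) :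
    ‖G (z - truncatedPinv G ε (G z))‖ ≤ ε * ‖z‖ := by
  refine le_of_sq_le_sq ?_ (by positivity)
  rw [norm_sq_map_eq_sum, mul_pow, ← (rightSingularBasis G).sum_sq_norm_inner_right z,
    Finset.mul_sum]
  refine Finset.sum_le_sum fun n _ => ?_
  rw [inner_sub_right]
  by_cases hn : ε < G.singularValues n
  · have h0 : (G.singularValues n : ℂ) ≠ 0 := by exact_mod_cast (hε.trans hn).ne'
    have h := inner_rightSingularBasis_truncatedPinv_of_lt G hε (G z) hn
    rw [inner_map_rightSingularBasis] at h
    rw [mul_left_cancel₀ (pow_ne_zero 2 h0) h]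
    simp
    positivity
  · rw [inner_rightSingularBasis_truncatedPinv, if_neg hn, sub_zero]
    gcongr
    · exact G.singularValues_nonneg n
    · exact not_lt.mp hn

end TruncatedSVD

/-! ### From a lower bound on `G` to the stability constants -/

section Approximation

variable {H : Type*} [NormedAddCommGroup H] [InnerProductSpace ℂ H]
  (Φ : ℕ → H) (ℓ : (M : ℕ) → Fin M → (H →ₗ[ℂ] ℂ)) {ε K : ℝ} {M N : ℕ}

theorem kappa_le (hε : 0 < ε) (hK : 0 ≤ K)
    (h : ∀ z, ‖synthesis Φ N z‖ ≤ K * ‖gram Φ ℓ M N z‖) : kappa Φ ℓ ε M N ≤ K := by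
  refine Real.sSup_le ?_ hK
  rintro _ ⟨y, -, hy, rfl⟩
  refine (h _).trans ((mul_le_mul_of_nonneg_left
    (norm_map_truncatedPinv_le (gram Φ ℓ M N) hε y) hK).trans ?_)
  rw [hy, mul_one]

theorem lam_le (hε : 0 < ε) (hK : 0 ≤ K)
    (h : ∀ z, ‖synthesis Φ N z‖ ≤ K * ‖gram Φ ℓ M N z‖) : lam Φ ℓ ε M N ≤ K := by
  rw [lam, inv_mul_le_iff₀ hε]
  refine Real.sSup_le ?_ (by positivity)
  rintro _ ⟨z, hz, rfl⟩
  have e : synthesis Φ N z - approx Φ ℓ ε M N (synthesis Φ N z) =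
      synthesis Φ N (z - truncatedPinv (gram Φ ℓ M N) ε (gram Φ ℓ M N z)) := by
    rw [map_sub]
    rfl
  have h1 := norm_map_sub_truncatedPinv_le (gram Φ ℓ M N) hε z
  rw [hz, mul_one] at h1
  rw [e, mul_comm ε]
  exact (h _).trans (mul_le_mul_of_nonneg_left h1 hK)

theorem norm_sq_gram (z : EuclideanSpace ℂ (Fin N)) :
    ‖gram Φ ℓ M N z‖ ^ 2 = ∑ m, ‖ℓ M m (synthesis Φ N z)‖ ^ 2 :=
  EuclideanSpace.norm_sq_eq _

end Approximation

/-! ### The logarithmic frame: exact tails and the sampling rate -/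

theorem inner_legendre_synthesis {N n : ℕ} (hn : N ≤ n)
    (z : EuclideanSpace ℂ (Fin (N + 1))) :
    ⟪legendre n, synthesis legendreLog (N + 1) z⟫_ℂ = z 0 * ⟪legendre n, logElem⟫_ℂ := by
  change ⟪legendre n, ∑ i, z i • legendreLog i⟫_ℂ = _
  rw [Fin.sum_univ_succ, inner_add_right, inner_smul_right, inner_sum]
  have : ∀ i : Fin N, ⟪legendre n, z i.succ • legendreLog i.succ⟫_ℂ = 0 := by
    intro i
    change ⟪legendre n, z i.succ • legendre i⟫_ℂ = 0
    rw [inner_smul_right, orthonormal_legendre.2 (by have := i.2; omega), mul_zero]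
  rw [Finset.sum_eq_zero fun i _ => this i, add_zero]
  rfl

theorem sum_norm_sq_legendreData (f : L2unit) (K : ℕ) :
    ∑ m, ‖legendreData K m f‖ ^ 2 = ∑ n ∈ Finset.range K, ‖⟪legendre n, f⟫_ℂ‖ ^ 2 :=
  Fin.sum_univ_eq_sum_range (fun n => ‖⟪legendre n, f⟫_ℂ‖ ^ 2) K

/-- Parseval, with the coefficients from index `M` on telescoping to `|z₀|²/M²`. -/
theorem norm_sq_synthesis_legendreLog {N M : ℕ} (hNM : N < M)
    (z : EuclideanSpace ℂ (Fin (N + 1))) :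
    ‖synthesis legendreLog (N + 1) z‖ ^ 2 =
      ∑ m, ‖legendreData M m (synthesis legendreLog (N + 1) z)‖ ^ 2 +
        ‖z 0‖ ^ 2 / (M : ℝ) ^ 2 := by
  set f := synthesis legendreLog (N + 1) z with hf
  have hS : ∀ K ≥ M, ∑ m, ‖legendreData K m f‖ ^ 2 = ∑ m, ‖legendreData M m f‖ ^ 2 +
      ‖z 0‖ ^ 2 * (1 / (M : ℝ) ^ 2 - 1 / (K : ℝ) ^ 2) := by
    intro K hK
    simp only [sum_norm_sq_legendreData]
    induction K, hK using Nat.le_induction with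
    | base => simp
    | succ K hK ih =>
      rw [Finset.sum_range_succ, ih, hf, inner_legendre_synthesis (by omega), norm_mul, mul_pow,
        norm_sq_inner_legendre_logElem (by omega)]
      ring
  have hlim : Tendsto (fun K : ℕ => ∑ m, ‖legendreData M m f‖ ^ 2 +
      ‖z 0‖ ^ 2 * (1 / (M : ℝ) ^ 2 - 1 / (K : ℝ) ^ 2)) atTop
      (nhds (∑ m, ‖legendreData M m f‖ ^ 2 + ‖z 0‖ ^ 2 * (1 / (M : ℝ) ^ 2 - 0))) := by
    refine tendsto_const_nhds.add (tendsto_const_nhds.mul (tendsto_const_nhds.sub ?_))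
    exact tendsto_const_div_pow (1 : ℝ) 2 two_ne_zero
  have h := tendsto_nhds_unique (tendsto_sum_norm_sq_legendreData f)
    (hlim.congr' ((eventually_ge_atTop M).mono fun K hK => (hS K hK).symm))
  rw [h]
  ring

theorem norm_synthesis_legendreLog_le {θ : ℝ} (hθ : 1 < θ) {N M : ℕ} (hN : 1 ≤ N) (hNM : N ≤ M)
    (hM : θ * (N : ℝ) ^ 2 ≤ (θ - 1) * (M : ℝ) ^ 2) (z : EuclideanSpace ℂ (Fin N)) :
    ‖synthesis legendreLog N z‖ ≤ θ * ‖gram legendreLog legendreData M N z‖ := by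
  obtain ⟨N, rfl⟩ : ∃ k, N = k + 1 := ⟨N - 1, by omega⟩
  refine le_of_sq_le_sq ?_ (by positivity)
  have h1 := norm_sq_synthesis_legendreLog (M := M) (by omega) z
  -- Taking as many samples as frame elements bounds `z₀` by the norm of the synthesized function.
  have h2 := norm_sq_synthesis_legendreLog (M := N + 1) (by omega) z
  rw [mul_pow, norm_sq_gram]
  set F := ‖synthesis legendreLog (N + 1) z‖ ^ 2
  set S := ∑ m, ‖legendreData M m (synthesis legendreLog (N + 1) z)‖ ^ 2
  have hS : 0 ≤ S := Finset.sum_nonneg fun _ _ => by positivity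
  have hF : ‖z 0‖ ^ 2 / ((N + 1 : ℕ) : ℝ) ^ 2 ≤ F := by
    rw [h2]
    exact le_add_of_nonneg_left (Finset.sum_nonneg fun _ _ => by positivity)
  have hN0 : (0 : ℝ) < ((N + 1 : ℕ) : ℝ) := by positivity
  have hM0 : (0 : ℝ) < M := by exact_mod_cast (by omega : 0 < M)
  have h3 : θ * (‖z 0‖ ^ 2 / (M : ℝ) ^ 2) ≤ (θ - 1) * (‖z 0‖ ^ 2 / ((N + 1 : ℕ) : ℝ) ^ 2) := by
    rw [← mul_div_assoc, ← mul_div_assoc, div_le_div_iff₀ (by positivity) (by positivity)]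
    nlinarith [mul_le_mul_of_nonneg_left hM (sq_nonneg ‖z 0‖)]
  have h4 := mul_le_mul_of_nonneg_left hF (by linarith : 0 ≤ θ - 1)
  have h5 : F ≤ θ * S := by
    have : θ * F = θ * S + θ * (‖z 0‖ ^ 2 / (M : ℝ) ^ 2) := by rw [h1]; ring
    linarith
  -- The estimate already holds with constant `√θ`; `θ > 1` weakens it to `θ`.
  calc F ≤ θ * S := h5
    _ ≤ θ ^ 2 * S := mul_le_mul_of_nonneg_right (by nlinarith) hS

theorem mem_stableSampleSizes {ε θ : ℝ} (hε : 0 < ε) (hθ : 1 < θ) {N M : ℕ} (hN : 1 ≤ N)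
    (hM : √(θ / (θ - 1)) * N ≤ M) :
    M ∈ stableSampleSizes legendreLog legendreData ε N θ := by
  have hθ1 : 0 < θ - 1 := by linarith
  have hc : 1 ≤ √(θ / (θ - 1)) := by
    rw [Real.one_le_sqrt, one_le_div hθ1]
    linarith
  have hNM : N ≤ M := by
    have : (N : ℝ) ≤ M := (le_mul_of_one_le_left (Nat.cast_nonneg N) hc).trans hM
    exact_mod_cast this
  have hsq : θ * (N : ℝ) ^ 2 ≤ (θ - 1) * (M : ℝ) ^ 2 := by
    have := pow_le_pow_left₀ (by positivity) hM 2
    rw [mul_pow, Real.sq_sqrt (by positivity), div_mul_eq_mul_div, div_le_iff₀ hθ1] at this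
    linarith
  have hb := norm_synthesis_legendreLog_le hθ hN hNM hsq
  have hθ0 : 0 ≤ θ := by linarith
  refine ⟨hNM, ?_, ?_⟩ <;> rw [lowerDataBound_legendreData, Real.sqrt_one, div_one]
  · exact kappa_le _ _ hε hθ0 hb
  · exact lam_le _ _ hε hθ0 hb

end FrameSampling

theorem mainTheorem9 (ε : ℝ) (hε : 0 < ε) (θ : ℝ) (hθ : 1 < θ) (N : ℕ) (hN : 1 ≤ N) :
    IsLeast
      (FrameSampling.stableSampleSizes
        FrameSampling.legendreLog FrameSampling.legendreData ε N θ)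
      (FrameSampling.stableSamplingRate
        FrameSampling.legendreLog FrameSampling.legendreData ε N θ) ∧
    (FrameSampling.stableSamplingRate
        FrameSampling.legendreLog FrameSampling.legendreData ε N θ : ℝ) ≤
      √(θ / (θ - 1)) * N + 1 := by
  -- Rounding the threshold up to an integer costs the final `+ 1`.
  have hmem := FrameSampling.mem_stableSampleSizes hε hθ hN (Nat.le_ceil (√(θ / (θ - 1)) * N))
  refine ⟨⟨Nat.sInf_mem ⟨_, hmem⟩, fun M hM => Nat.sInf_le hM⟩, ?_⟩
  refine le_trans (Nat.cast_le.mpr (Nat.sInf_le hmem)) ?_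
  exact (Nat.ceil_lt_add_one (by positivity)).le
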